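/- Let $(\Omega,\mathcal B,\mu)$ be a probability space, $T:\Omega\to\Omega$ a non-singular map, and $\alpha$ a countable measurable partition of $\Omega$ modulo $\mu$. Write $\alpha_0^{n-1}=\bigvee_{i=0}^{n-1}T^{-i}\alpha$. For $r\in(0,1)$ let $r(x,y)=r^{m(x,y)}$, where $m(x,y)$ is the least $n\ge 1$ such that $T^{n-1}x$ and $T^{n-1}y$ belong to different members of $\alpha$ (the null set left uncovered by $\alpha$ counts as one more member; $r(x,y)=0$ if there is no such $n$). Let $T$ be a Gibbs–Markov map with respect to $\alpha$ and $r$, i.e. (a) $\sigma(\{T^{-n}\alpha:n\ge 0\})=\mathcal B$ mod $\mu$; (b) $\inf_{a\in\alpha}\mu(Ta)>0$; (c) for every $a\in\alpha$, $Ta\in\sigma(\alpha)$ mod $\mu$, and $T|_a$ is invertible (injective, with inverse measurable mod $\mu$) and non-singular; (d) there is $M>0$ such that for all $n\ge1$ and $a\in\alpha_0^{n-1}$, the Radon–Nikodym derivative $v_a'$ of the inverse branch $v_a:T^na\to a$ of $T^n$ satisfies $\left|\frac{v_a'(x)}{v_a'(y)}-1\right|\le M\,r(x,y)$ for a.e.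 $x,y\in T^na$. Suppose moreover that $T$ preserves $\mu$ and is topologically mixing: for all $a,b\in\alpha$ there is $n_{a,b}$ such that $T^na\supset b$ (mod $\mu$) for all $n\ge n_{a,b}$. Let $f:\Omega\to\mathbb R$ be measurable and suppose that $e^{2\pi i k f(x)}=g(x)/g(Tx)$ for a.e. $x$, for some integer $k\ne0$ and some measurable $g:\Omega\to\mathbb C$. (1) If $f$ is $\alpha$-measurable (mod $\mu$), then $g$ is $\beta$-measurable (mod $\mu$), where $\beta$ is the finest countable measurable partition mod $\mu$ such that $\sigma(T\alpha)=\sigma(\beta)$ mod $\mu$, with $T\alpha=\{Ta:a\in\alpha\}$ (such a $\beta$ exists). (2) Suppose that $f$ is locally Lipschitz, i.e. there is $D<\infty$ with $|f(x)-f(y)|\le D\,r(x,y)$ for all $a\in\alpha$ and all $x,y\in a$. Let $p$ be a fixed point of $T$ such that, with respect to the metric $r$, $p$ lies in the interior of a member of $\alpha$, every open ball around $p$ has positive measure, and $T$ and $f$ are continuous at $p$. Then $e^{2\pi i k f(p)}=1$. -/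

import Mathlib

open MeasureTheory

namespace GibbsMarkov

variable {Ω : Type*}

/-- `γ` is a countable measurable partition of `Ω` modulo `μ`: its members are measurable and
pairwise disjoint, and they cover `Ω` up to a `μ`-null set. -/
structure IsPartitionMod [MeasurableSpace Ω] (μ : Measure Ω) (γ : Set (Set Ω)) : Prop where
  countable : γ.Countable
  measurableSet : ∀ a ∈ γ, MeasurableSet a
  disjoint : ∀ a ∈ γ, ∀ b ∈ γ, a ≠ b → Disjoint a b
  cover : μ (⋃₀ γ)ᶜ = 0

/-- Equality modulo `μ` of two `σ`-algebras: every set of either one coincides, up to a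
`μ`-null set, with a set of the other one. -/
def EqMod [MeasurableSpace Ω] (μ : Measure Ω) (m₁ m₂ : MeasurableSpace Ω) : Prop :=
  (∀ s, MeasurableSet[m₁] s → ∃ t, MeasurableSet[m₂] t ∧ s =ᵐ[μ] t) ∧
  (∀ t, MeasurableSet[m₂] t → ∃ s, MeasurableSet[m₁] s ∧ t =ᵐ[μ] s)

/-- `h` is `γ`-measurable (modulo `μ`): it is `μ`-a.e. equal to a function that is measurable
with respect to the `σ`-algebra generated by `γ`. -/
def MeasurableMod [MeasurableSpace Ω] (μ : Measure Ω) (γ : Set (Set Ω))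
    {E : Type*} [MeasurableSpace E] (h : Ω → E) : Prop :=
  ∃ h' : Ω → E, Measurable[MeasurableSpace.generateFrom γ] h' ∧ h =ᵐ[μ] h'

/-- The points `x`, `y` belong to different members of `α`. The null set that `α` may leave
uncovered is counted as one more member. -/
def Separated (α : Set (Set Ω)) (x y : Ω) : Prop :=
  ∃ a ∈ α, ¬ (x ∈ a ↔ y ∈ a)

open Classical in
/-- The metric `r(x, y) = r ^ m(x, y)`, where `m(x, y) ≥ 1` is the least `n ≥ 1` such that
`T^(n-1) x` and `T^(n-1) y` belong to different members of `α`; it is `0` if there is no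
such `n`. (`Nat.find h` is `m(x, y) - 1`.) -/
noncomputable def symDist (α : Set (Set Ω)) (T : Ω → Ω) (r : ℝ) (x y : Ω) : ℝ :=
  if h : ∃ n : ℕ, Separated α (T^[n] x) (T^[n] y) then r ^ (Nat.find h + 1) else 0

/-- The open ball around `p` for `symDist`. -/
def symBall (α : Set (Set Ω)) (T : Ω → Ω) (r : ℝ) (p : Ω) (ε : ℝ) : Set Ω :=
  {x | symDist α T r x p < ε}

/-- The members of the refined partition `α ∨ T⁻¹ α ∨ ⋯ ∨ T^(-(n-1)) α` (some of the listed
sets may be empty). -/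
def cylinders (α : Set (Set Ω)) (T : Ω → Ω) (n : ℕ) : Set (Set Ω) :=
  {c | ∃ w : Fin n → Set Ω, (∀ i, w i ∈ α) ∧ c = ⋂ i : Fin n, T^[(i : ℕ)] ⁻¹' (w i)}

/-- The Radon-Nikodym derivative `v' = d(μ ∘ v) / dμ` of the inverse branch
`v : T^n c → c` of `T^n`. As `T^n` is injective on `c`, `v (E ∩ T^n c) = c ∩ T^(-n) E`, so that
the measure `E ↦ μ (v (E ∩ T^n c))` is the image under `T^n` of the restriction of `μ` to `c`. -/
noncomputable def branchDeriv [MeasurableSpace Ω] (μ : Measure Ω) (T : Ω → Ω) (n : ℕ)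
    (c : Set Ω) (x : Ω) : ℝ :=
  (((μ.restrict c).map (T^[n])).rnDeriv μ x).toReal

/-- `T` is a Gibbs-Markov map of `(Ω, μ)` with respect to the partition `α`, with the
parameter `r` in the metric `symDist α T r`. -/
structure IsGibbsMarkov [MeasurableSpace Ω] (μ : Measure Ω) (α : Set (Set Ω)) (T : Ω → Ω)
    (r : ℝ) : Prop where
  partition : IsPartitionMod μ α
  measurable : Measurable T
  /-- `T` is non-singular -/
  nonsingular : ∀ E, MeasurableSet E → (μ (T ⁻¹' E) = 0 ↔ μ E = 0)
  /-- strong generator -/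
  generator : EqMod μ
    (MeasurableSpace.generateFrom {s | ∃ n : ℕ, ∃ a ∈ α, s = T^[n] ⁻¹' a}) ‹MeasurableSpace Ω›
  /-- big images -/
  bigImage : 0 < ⨅ a ∈ α, μ (T '' a)
  /-- Markov property -/
  markov : ∀ a ∈ α, ∃ s, MeasurableSet[MeasurableSpace.generateFrom α] s ∧ T '' a =ᵐ[μ] s
  /-- the restriction of `T` to each member of `α` is invertible ... -/
  injOn : ∀ a ∈ α, Set.InjOn T a
  /-- ... with a measurable (modulo `μ`) inverse ... -/
  image_measurable : ∀ a ∈ α, ∀ E ⊆ a, MeasurableSet E → NullMeasurableSet (T '' E) μ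
  /-- ... and non-singular -/
  image_nonsingular : ∀ a ∈ α, ∀ E ⊆ a, MeasurableSet E → (μ (T '' E) = 0 ↔ μ E = 0)
  r_pos : 0 < r
  r_lt_one : r < 1
  /-- bounded distortion of the inverse branches -/
  distortion : ∃ M : ℝ, 0 < M ∧ ∀ n : ℕ, 1 ≤ n → ∀ c ∈ cylinders α T n,
    ∀ᵐ x ∂(μ.restrict (T^[n] '' c)), ∀ᵐ y ∂(μ.restrict (T^[n] '' c)),
      |branchDeriv μ T n c x / branchDeriv μ T n c y - 1| ≤ M * symDist α T r x y

/-- Topological mixing with respect to `α` (inclusions of sets are modulo `μ`). -/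
def TopMixing [MeasurableSpace Ω] (μ : Measure Ω) (α : Set (Set Ω)) (T : Ω → Ω) : Prop :=
  ∀ a ∈ α, ∀ b ∈ α, ∃ N : ℕ, ∀ n ≥ N, μ (b \ (T^[n] '' a)) = 0

/-- `β` is a partition modulo `μ` with `σ(β) = σ(T α)` modulo `μ`. -/
def GeneratesImage [MeasurableSpace Ω] (μ : Measure Ω) (α : Set (Set Ω)) (T : Ω → Ω)
    (β : Set (Set Ω)) : Prop :=
  IsPartitionMod μ β ∧
    EqMod μ (MeasurableSpace.generateFrom ((fun a => T '' a) '' α))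
      (MeasurableSpace.generateFrom β)

/-- `β` is the finest partition with `σ(β) = σ(T α)`; everything is modulo `μ`. -/
def IsImagePartition [MeasurableSpace Ω] (μ : Measure Ω) (α : Set (Set Ω)) (T : Ω → Ω)
    (β : Set (Set Ω)) : Prop :=
  GeneratesImage μ α T β ∧
    ∀ γ, GeneratesImage μ α T γ → ∀ b ∈ β, ∃ c ∈ γ, μ (b \ c) = 0

/-- `f` is locally Lipschitz: it is Lipschitz for `symDist` on the members of `α`, with the
same constant for all of them. -/
def LocallyLip (α : Set (Set Ω)) (T : Ω → Ω) (r : ℝ) (f : Ω → ℝ) : Prop :=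
  ∃ D : ℝ, ∀ a ∈ α, ∀ x ∈ a, ∀ y ∈ a, |f x - f y| ≤ D * symDist α T r x y

end GibbsMarkov

namespace GibbsMarkov

open Filter Topology Set
open scoped ENNReal

variable {Ω : Type*}

/-! The core is a regularity statement for transfer functions, `ae_norm_sub_le`. Let `g = exp(iκf) g
∘ T` with `|g| ≤ 1`. Since the cylinders generate, martingale convergence yields cylinders ending in
a prescribed `a ∈ α` on most of which `g` is nearly constant (`exists_cyl_nearly_const`). A cylinder
of length `n` with positive measure is mapped by `T^n` onto `T a` mod `μ`, and `g ∘ T^n = exp(-iκ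
S_n f) g`, where the Birkhoff sum `S_n f` oscillates by at most `D r^j / (1 - r)` between points of
the cylinder whose images share their next `j` symbols (`abs_birkhoffSum_sub_le`). Bounded
distortion carries "most of the cylinder" over to "most of `T a`" with a constant independent of `n`
(`exists_measure_inter_image_mul_le`). Letting the errors tend to zero, `g` oscillates by at most a
constant times `r^j` on `T a` intersected with a cylinder of length `j`.

For `α`-measurable `f` one may take `D = 0`, so `g` is constant on each `T a`, and each member of
the finest partition lies in some `T a` mod `μ`. For locally Lipschitz `f`, the values `g y` and `g
(T y)` are close when `y` is near the fixed point, while `|g|` is a positive constant there; hence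
`exp(iκ f y)` tends to `1` as `y` approaches `p`.

An unbounded `g` is first moved into the unit disc by an injective map that commutes with rotations
(`discEmbed`). -/

theorem mem_iff_of_generateFrom {C : Set (Set Ω)} {x y : Ω} (h : ∀ t ∈ C, (x ∈ t ↔ y ∈ t))
    {s : Set Ω} (hs : MeasurableSet[MeasurableSpace.generateFrom C] s) : x ∈ s ↔ y ∈ s := by
  induction s, hs using MeasurableSpace.generateFrom_induction with
  | hC t ht _ => exact h t ht
  | empty => simp
  | compl t _ ih => simp [ih]
  | iUnion s _ ih => simp [ih]

theorem eq_of_measurable_generateFrom {E : Type*} [MeasurableSpace E]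
    [MeasurableSingletonClass E] {C : Set (Set Ω)} {x y : Ω} (h : ∀ t ∈ C, (x ∈ t ↔ y ∈ t))
    {φ : Ω → E} (hφ : Measurable[MeasurableSpace.generateFrom C] φ) : φ x = φ y :=
  ((mem_iff_of_generateFrom h (hφ (measurableSet_singleton (φ x)))).1 rfl).symm

theorem mem_iff_of_mem_partition [MeasurableSpace Ω] {μ : Measure Ω} {γ : Set (Set Ω)}
    (hγ : IsPartitionMod μ γ) {a : Set Ω} (ha : a ∈ γ) {x y : Ω} (hx : x ∈ a) (hy : y ∈ a)
    {b : Set Ω} (hb : b ∈ γ) : x ∈ b ↔ y ∈ b := by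
  by_cases hab : a = b
  · subst hab; simp [hx, hy]
  · have := Set.disjoint_left.1 (hγ.disjoint a ha b hb hab)
    simp [this hx, this hy]

/-! ### Cylinders and the symbolic metric -/

/-- The cylinder of the points whose itinerary starts with the word `w`. -/
def cyl (T : Ω → Ω) {n : ℕ} (w : Fin n → Set Ω) : Set Ω :=
  ⋂ i : Fin n, T^[(i : ℕ)] ⁻¹' (w i)

theorem mem_cyl {T : Ω → Ω} {n : ℕ} {w : Fin n → Set Ω} {x : Ω} :
    x ∈ cyl T w ↔ ∀ i : Fin n, T^[(i : ℕ)] x ∈ w i := by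
  simp [cyl]

theorem cyl_succ (T : Ω → Ω) {n : ℕ} (w : Fin (n + 1) → Set Ω) :
    cyl T w = w 0 ∩ T ⁻¹' cyl T (Fin.tail w) := by
  ext x
  simp [mem_cyl, Fin.forall_fin_succ, Fin.tail]

theorem measurableSet_cyl [MeasurableSpace Ω] {T : Ω → Ω} (hT : Measurable T) {n : ℕ}
    {w : Fin n → Set Ω} (hw : ∀ i, MeasurableSet (w i)) : MeasurableSet (cyl T w) :=
  MeasurableSet.iInter fun i => (hT.iterate i) (hw i)

theorem cyl_mem_cylinders {α : Set (Set Ω)} {T : Ω → Ω} {n : ℕ}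
    {w : Fin n → Set Ω} (hw : ∀ i, w i ∈ α) : cyl T w ∈ cylinders α T n :=
  ⟨w, hw, rfl⟩

theorem image_cyl_subset (T : Ω → Ω) {n : ℕ} (w : Fin (n + 1) → Set Ω) :
    T^[n + 1] '' cyl T w ⊆ T '' w (Fin.last n) := by
  rintro _ ⟨x, hx, rfl⟩
  rw [Function.iterate_succ_apply']
  exact ⟨_, mem_cyl.1 hx (Fin.last n), rfl⟩

theorem symDist_nonneg {α : Set (Set Ω)} {T : Ω → Ω} {r : ℝ} (hr : 0 < r) (x y : Ω) :
    0 ≤ symDist α T r x y := by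
  unfold symDist; split_ifs <;> positivity

theorem symDist_le_of_forall_lt {α : Set (Set Ω)} {T : Ω → Ω} {r : ℝ} (hr : 0 < r) (hr1 : r < 1)
    {x y : Ω} {n : ℕ} (h : ∀ i < n, ¬ Separated α (T^[i] x) (T^[i] y)) :
    symDist α T r x y ≤ r ^ (n + 1) := by
  classical
  unfold symDist
  split_ifs with hs
  · refine pow_le_pow_of_le_one hr.le hr1.le ?_
    have := (Nat.le_find_iff hs n).2 h
    convert Nat.succ_le_succ this
  · positivity

theorem symDist_le {α : Set (Set Ω)} {T : Ω → Ω} {r : ℝ} (hr : 0 < r) (hr1 : r < 1)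
    {x y : Ω} {n : ℕ} (h : ∀ i < n, ¬ Separated α (T^[i] x) (T^[i] y)) :
    symDist α T r x y ≤ r ^ n :=
  (symDist_le_of_forall_lt hr hr1 h).trans (pow_le_pow_of_le_one hr.le hr1.le n.le_succ)

theorem symDist_le_one {α : Set (Set Ω)} {T : Ω → Ω} {r : ℝ} (hr : 0 < r) (hr1 : r < 1)
    (x y : Ω) : symDist α T r x y ≤ 1 := by
  simpa using symDist_le (α := α) (T := T) (x := x) (y := y) (n := 0) hr hr1 (by simp)

theorem not_separated_of_mem [MeasurableSpace Ω] {μ : Measure Ω} {α : Set (Set Ω)}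
    (hα : IsPartitionMod μ α) {a : Set Ω} (ha : a ∈ α) {x y : Ω} (hx : x ∈ a) (hy : y ∈ a) :
    ¬ Separated α x y := by
  rintro ⟨b, hb, h⟩
  exact h (mem_iff_of_mem_partition hα ha hx hy hb)

theorem not_separated_of_mem_cyl [MeasurableSpace Ω] {μ : Measure Ω} {α : Set (Set Ω)}
    (hα : IsPartitionMod μ α) {T : Ω → Ω} {n : ℕ} {w : Fin n → Set Ω} (hw : ∀ i, w i ∈ α)
    {x y : Ω} (hx : x ∈ cyl T w) (hy : y ∈ cyl T w) {i : ℕ} (hi : i < n) :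
    ¬ Separated α (T^[i] x) (T^[i] y) :=
  not_separated_of_mem hα (hw ⟨i, hi⟩) (mem_cyl.1 hx ⟨i, hi⟩) (mem_cyl.1 hy ⟨i, hi⟩)

theorem word_eq_of_mem_cyl [MeasurableSpace Ω] {μ : Measure Ω} {α : Set (Set Ω)}
    (hα : IsPartitionMod μ α) {T : Ω → Ω} {n : ℕ} {w w' : Fin n → Set Ω} (hw : ∀ i, w i ∈ α)
    (hw' : ∀ i, w' i ∈ α) {x : Ω} (hx : x ∈ cyl T w) (hx' : x ∈ cyl T w') : w = w' := by
  funext i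
  by_contra hne
  exact Set.disjoint_left.1 (hα.disjoint _ (hw i) _ (hw' i) hne) (mem_cyl.1 hx i)
    (mem_cyl.1 hx' i)

/-! ### Null sets and images of cylinders -/

namespace IsGibbsMarkov

variable [MeasurableSpace Ω] {μ : Measure Ω} {α : Set (Set Ω)} {T : Ω → Ω} {r : ℝ}

theorem measure_image_pos (hT : IsGibbsMarkov μ α T r) {a : Set Ω} (ha : a ∈ α) :
    0 < μ (T '' a) :=
  hT.bigImage.trans_le (iInf₂_le a ha)

theorem measure_pos (hT : IsGibbsMarkov μ α T r) {a : Set Ω} (ha : a ∈ α) : 0 < μ a := by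
  refine pos_iff_ne_zero.2 fun h => (hT.measure_image_pos ha).ne' ?_
  exact (hT.image_nonsingular a ha a subset_rfl (hT.partition.measurableSet a ha)).2 h

theorem measurableSet_of_generateFrom (hT : IsGibbsMarkov μ α T r) {s : Set Ω}
    (hs : MeasurableSet[MeasurableSpace.generateFrom α] s) : MeasurableSet s :=
  MeasurableSpace.generateFrom_le hT.partition.measurableSet _ hs

theorem quasiMeasurePreserving (hT : IsGibbsMarkov μ α T r) :
    Measure.QuasiMeasurePreserving T μ μ := by
  refine ⟨hT.measurable, Measure.AbsolutelyContinuous.mk fun s hs h => ?_⟩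
  rw [Measure.map_apply hT.measurable hs]
  exact (hT.nonsingular s hs).2 h

theorem ae_mem (hT : IsGibbsMarkov μ α T r) : ∀ᵐ x ∂μ, ∀ i : ℕ, ∃ a ∈ α, T^[i] x ∈ a := by
  refine ae_all_iff.2 fun i => (hT.quasiMeasurePreserving.iterate i).ae (p := fun x => ∃ a ∈ α, x ∈ a) ?_
  rw [ae_iff]
  convert hT.partition.cover using 2
  ext x; simp

/-- By the Markov property `T '' a` is, up to a null set, a set of `σ(α)`, and such a set contains
or misses each member of `α`. -/
theorem subset_or_disjoint_image (hT : IsGibbsMarkov μ α T r) {a b : Set Ω} (ha : a ∈ α)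
    (hb : b ∈ α) : μ (b \ T '' a) = 0 ∨ μ (b ∩ T '' a) = 0 := by
  obtain ⟨s, hs, hsa⟩ := hT.markov a ha
  by_cases h : ∃ x ∈ b, x ∈ s
  · left
    obtain ⟨x, hx, hxs⟩ := h
    have : b \ s = ∅ := Set.sdiff_eq_empty.2 fun y hy =>
      (mem_iff_of_generateFrom (fun t ht => mem_iff_of_mem_partition hT.partition hb hx hy ht)
        hs).1 hxs
    rw [measure_congr ((ae_eq_refl b).diff hsa), this, measure_empty]
  · right
    have : b ∩ s = ∅ := by
      ext x; simp only [mem_inter_iff, mem_empty_iff_false, iff_false]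
      exact fun hx => h ⟨x, hx.1, hx.2⟩
    rw [measure_congr ((ae_eq_refl b).inter hsa), this, measure_empty]

/-- `S` need not be measurable: non-singularity is applied to its measurable hull, cut down to `a`.
-/
theorem measure_image_eq_zero (hT : IsGibbsMarkov μ α T r) {a : Set Ω} (ha : a ∈ α)
    {S : Set Ω} (hSa : S ⊆ a) (hS : μ S = 0) : μ (T '' S) = 0 := by
  have hm := hT.partition.measurableSet a ha
  have h0 : μ (toMeasurable μ S ∩ a) = 0 :=
    measure_mono_null inter_subset_left (by rwa [measure_toMeasurable])
  refine measure_mono_null (image_mono (subset_inter (subset_toMeasurable μ S) hSa)) ?_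
  exact (hT.image_nonsingular a ha _ inter_subset_right
    ((measurableSet_toMeasurable μ S).inter hm)).2 h0

theorem measure_image_iterate_eq_zero (hT : IsGibbsMarkov μ α T r) {n : ℕ}
    {w : Fin n → Set Ω} (hw : ∀ i, w i ∈ α) {S : Set Ω} (hSw : S ⊆ cyl T w) (hS : μ S = 0) :
    μ (T^[n] '' S) = 0 := by
  induction n generalizing S with
  | zero => simpa using hS
  | succ n ih =>
    rw [Function.iterate_succ, image_comp]
    rw [cyl_succ] at hSw
    refine ih (w := Fin.tail w) (fun i => hw _) ?_ ?_
    · rintro _ ⟨x, hx, rfl⟩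
      exact (hSw hx).2
    · exact hT.measure_image_eq_zero (hw 0) (fun x hx => (hSw hx).1) hS

/-- A positive-measure cylinder is a genuinely admissible word, so each image covers the next letter
mod `μ`. In the induction on the tail, the part of the tail cylinder outside `T '' w 0` is null, and
its image stays null. -/
theorem image_diff_image_cyl (hT : IsGibbsMarkov μ α T r) {n : ℕ}
    {w : Fin (n + 1) → Set Ω} (hw : ∀ i, w i ∈ α) (hpos : μ (cyl T w) ≠ 0) :
    μ (T '' w (Fin.last n) \ T^[n + 1] '' cyl T w) = 0 := by
  induction n with
  | zero =>
    have : cyl T w = w 0 := by ext x; simp [mem_cyl]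
    simp [this]
  | succ n ih =>
    have hw' : ∀ i, Fin.tail w i ∈ α := fun i => hw _
    have hcyl := cyl_succ T w
    have hsub : cyl T (Fin.tail w) ⊆ w 1 := fun x hx => mem_cyl.1 hx 0
    have h1 : μ (w 1 \ T '' w 0) = 0 := by
      refine (hT.subset_or_disjoint_image (hw 0) (hw 1)).resolve_right fun h => hpos ?_
      refine measure_mono_null ?_ (hT.quasiMeasurePreserving.preimage_null h)
      rw [hcyl]
      exact fun x hx => ⟨hsub hx.2, x, hx.1, rfl⟩
    have h2 : μ (cyl T (Fin.tail w)) ≠ 0 := fun h => hpos <| by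
      rw [hcyl]
      exact measure_mono_null inter_subset_right (hT.quasiMeasurePreserving.preimage_null h)
    have h3 : μ (T^[n + 1] '' (cyl T (Fin.tail w) \ T '' w 0)) = 0 :=
      hT.measure_image_iterate_eq_zero hw' sdiff_subset
        (measure_mono_null (sdiff_subset_sdiff_left hsub) h1)
    refine measure_mono_null ?_ (measure_union_null (ih hw' h2) h3)
    rintro y ⟨hy, hy'⟩
    by_cases hyc : y ∈ T^[n + 1] '' cyl T (Fin.tail w)
    · right
      obtain ⟨x, hx, rfl⟩ := hyc
      refine ⟨x, ⟨hx, ?_⟩, rfl⟩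
      rintro ⟨z, hz, rfl⟩
      refine hy' ⟨z, ?_, rfl⟩
      rw [hcyl]
      exact ⟨hz, hx⟩
    · exact Or.inl ⟨hy, hyc⟩

end IsGibbsMarkov

/-! ### Bounded distortion and density of cylinders -/

namespace IsGibbsMarkov

variable [MeasurableSpace Ω] {μ : Measure Ω} {α : Set (Set Ω)} {T : Ω → Ω} {r : ℝ}

theorem image_cyl_ae_eq (hT : IsGibbsMarkov μ α T r) {n : ℕ}
    {w : Fin (n + 1) → Set Ω} (hw : ∀ i, w i ∈ α) (hpos : μ (cyl T w) ≠ 0) :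
    T^[n + 1] '' cyl T w =ᵐ[μ] T '' w (Fin.last n) :=
  (LE.le.eventuallyLE (image_cyl_subset T w)).antisymm
    (ae_le_set.2 (hT.image_diff_image_cyl hw hpos))

/-- Bounded distortion: the relative size of a subset of `T a` is at most a constant times the
relative size of its preimage in a cylinder that ends with `a`. -/
theorem exists_measure_inter_image_mul_le [IsProbabilityMeasure μ] (hT : IsGibbsMarkov μ α T r) :
    ∃ C : ℝ≥0∞, C ≠ 0 ∧ C ≠ ∞ ∧ ∀ (n : ℕ) (w : Fin (n + 1) → Set Ω), (∀ i, w i ∈ α) →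
      ∀ E, MeasurableSet E → μ (E ∩ T '' w (Fin.last n)) * μ (cyl T w) ≤
        C * μ (cyl T w ∩ T^[n + 1] ⁻¹' E) := by
  obtain ⟨M, hM, hdist⟩ := hT.distortion
  refine ⟨ENNReal.ofReal (1 + M), (ENNReal.ofReal_pos.2 (by linarith)).ne',
    ENNReal.ofReal_ne_top, fun n w hw E hE => ?_⟩
  rcases eq_or_ne (μ (cyl T w)) 0 with h0 | hpos
  · simp [h0]
  have hd := hdist (n + 1) (Nat.le_add_left 1 n) _ (cyl_mem_cylinders (T := T) hw)
  obtain ⟨s, hs, hsa⟩ := hT.markov _ (hw (Fin.last n))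
  replace hs := hT.measurableSet_of_generateFrom hs
  have hcs : T^[n + 1] '' cyl T w =ᵐ[μ] s := (hT.image_cyl_ae_eq hw hpos).trans hsa
  have hTm := hT.measurable.iterate (n + 1)
  have hq := hT.quasiMeasurePreserving.iterate (n + 1)
  unfold branchDeriv at hd
  set ν := (μ.restrict (cyl T w)).map T^[n + 1] with hν
  have hνap : ∀ F, MeasurableSet F → ν F = μ (cyl T w ∩ T^[n + 1] ⁻¹' F) := fun F hF => by
    rw [hν, Measure.map_apply hTm hF, Measure.restrict_apply (hTm hF), inter_comm]
  have hνμ : ν ≪ μ := by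
    refine Measure.AbsolutelyContinuous.mk fun F hF h => ?_
    rw [hνap F hF]
    exact measure_mono_null inter_subset_right (hq.preimage_null h)
  have hνfin : IsFiniteMeasure ν := by rw [hν]; infer_instance
  set W := ν.rnDeriv μ with hW
  have hWm : Measurable W := Measure.measurable_rnDeriv ν μ
  have hWint : ∀ F, ∫⁻ x in F, W x ∂μ = ν F := Measure.setLIntegral_rnDeriv hνμ
  rw [Measure.restrict_congr_set hcs] at hd
  -- Bounding the distance by `1` leaves a measurable condition on the pair, so the two a.e.
  -- quantifiers can be exchanged: `y` is then fixed and `x` integrated out.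
  have hd1 : ∀ᵐ x ∂(μ.restrict s), ∀ᵐ y ∂(μ.restrict s),
      |(W x).toReal / (W y).toReal - 1| ≤ M := by
    filter_upwards [hd] with x hx
    filter_upwards [hx] with y hy
    exact hy.trans (mul_le_of_le_one_right hM.le (symDist_le_one hT.r_pos hT.r_lt_one x y))
  rw [Measure.ae_ae_comm (p := fun x y => |(W x).toReal / (W y).toReal - 1| ≤ M)
    (measurableSet_le (by fun_prop) measurable_const)] at hd1
  have hWtop : ∀ᵐ y ∂(μ.restrict s), W y < ∞ := ae_restrict_of_ae (Measure.rnDeriv_lt_top ν μ)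
  -- The zero set of the density pulls back to a null part of the cylinder, whose image is again
  -- null.
  have hWz : ∀ᵐ y ∂(μ.restrict s), W y ≠ 0 := by
    have hZ : MeasurableSet {y | W y = 0} := hWm (measurableSet_singleton 0)
    rw [ae_iff]
    simp only [ne_eq, not_not]
    rw [Measure.restrict_apply hZ, inter_comm, measure_congr (hcs.symm.inter (ae_eq_refl {y | W y = 0}))]
    have h1 : μ (cyl T w ∩ T^[n + 1] ⁻¹' {y | W y = 0}) = 0 := by
      rw [← hνap _ hZ, ← hWint, setLIntegral_congr_fun hZ (g := fun _ => 0) fun y hy => hy]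
      simp
    have h2 := hT.measure_image_iterate_eq_zero hw inter_subset_left h1
    rwa [image_inter_preimage] at h2
  have hνs : ν s = μ (cyl T w) := by
    have h1 : ν sᶜ = 0 := by
      rw [hνap _ hs.compl]
      have h2 : μ (T^[n + 1] '' cyl T w ∩ sᶜ) = 0 := ae_le_set.1 hcs.le
      refine measure_mono_null ?_ (hq.preimage_null h2)
      exact fun x hx => ⟨⟨x, hx.1, rfl⟩, hx.2⟩
    have h3 := measure_add_measure_compl (μ := ν) hs
    rw [h1, add_zero] at h3
    rw [h3, hνap _ MeasurableSet.univ, preimage_univ, inter_univ]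
  -- Integrating `W x ≤ (1 + M) W y` over `x ∈ s` gives the total mass `ν s = μ (cyl T w)` on the
  -- left; on the right `μ s ≤ 1`.
  have hlow : ∀ᵐ y ∂(μ.restrict s), μ (cyl T w) ≤ ENNReal.ofReal (1 + M) * W y := by
    filter_upwards [hd1, hWtop, hWz] with y hy hy1 hy0
    have hypos : 0 < (W y).toReal := ENNReal.toReal_pos hy0 hy1.ne
    rw [← hνs, ← hWint]
    calc ∫⁻ x in s, W x ∂μ ≤ ∫⁻ _ in s, ENNReal.ofReal (1 + M) * W y ∂μ := by
          refine lintegral_mono_ae ?_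
          filter_upwards [hy, hWtop] with x hx hx1
          have : (W x).toReal ≤ (1 + M) * (W y).toReal := by
            rw [← div_le_iff₀ hypos]
            linarith [(abs_le.1 hx).2]
          rw [← ENNReal.ofReal_toReal hx1.ne, ← ENNReal.ofReal_toReal hy1.ne,
            ← ENNReal.ofReal_mul (by linarith)]
          exact ENNReal.ofReal_le_ofReal this
      _ ≤ ENNReal.ofReal (1 + M) * W y := by
          rw [setLIntegral_const]
          exact mul_le_of_le_one_right' prob_le_one
  calc μ (E ∩ T '' w (Fin.last n)) * μ (cyl T w)
      = μ (E ∩ s) * μ (cyl T w) := by rw [measure_congr ((ae_eq_refl E).inter hsa)]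
    _ = ∫⁻ _ in E, μ (cyl T w) ∂(μ.restrict s) := by
        rw [setLIntegral_const, Measure.restrict_apply hE, mul_comm]
    _ ≤ ∫⁻ y in E, ENNReal.ofReal (1 + M) * W y ∂(μ.restrict s) :=
        lintegral_mono_ae (ae_restrict_of_ae hlow)
    _ = ENNReal.ofReal (1 + M) * ν (E ∩ s) := by
        rw [lintegral_const_mul _ hWm, Measure.restrict_restrict hE, hWint]
    _ ≤ ENNReal.ofReal (1 + M) * μ (cyl T w ∩ T^[n + 1] ⁻¹' E) := by
        rw [← hνap E hE]
        gcongr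
        exact inter_subset_left

/-- The `σ`-algebra generated by the first `n` iterates of the partition. -/
def cylFiltration (hT : IsGibbsMarkov μ α T r) : Filtration ℕ ‹MeasurableSpace Ω› where
  seq n := MeasurableSpace.generateFrom {s | ∃ j < n, ∃ a ∈ α, s = T^[j] ⁻¹' a}
  mono' m n hmn := MeasurableSpace.generateFrom_mono fun _ ⟨j, hj, h⟩ => ⟨j, hj.trans_le hmn, h⟩
  le' n := MeasurableSpace.generateFrom_le fun s hs => by
    obtain ⟨j, -, a, ha, rfl⟩ := hs
    exact hT.measurable.iterate j (hT.partition.measurableSet a ha)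

theorem eq_of_mem_cyl (hT : IsGibbsMarkov μ α T r) {E : Type*} [MeasurableSpace E]
    [MeasurableSingletonClass E] {n : ℕ} {φ : Ω → E}
    (hφ : Measurable[hT.cylFiltration n] φ) {w : Fin n → Set Ω} (hw : ∀ i, w i ∈ α)
    {x y : Ω} (hx : x ∈ cyl T w) (hy : y ∈ cyl T w) : φ x = φ y := by
  refine eq_of_measurable_generateFrom ?_ hφ
  rintro _ ⟨j, hj, a, ha, rfl⟩
  exact mem_iff_of_mem_partition hT.partition (hw ⟨j, hj⟩) (mem_cyl.1 hx ⟨j, hj⟩)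
    (mem_cyl.1 hy ⟨j, hj⟩) ha

/-- The cylinders generate only modulo `μ`, so the two `σ`-algebras may differ; it suffices that
each measurable set can be replaced by an a.e. equal cylinder-measurable one under the integral. -/
theorem condExp_iSup_cylFiltration [IsProbabilityMeasure μ] (hT : IsGibbsMarkov μ α T r)
    {h : Ω → ℝ} (hh : Integrable h μ) : μ[h | ⨆ n, hT.cylFiltration n] =ᵐ[μ] h := by
  have hle : ⨆ n, hT.cylFiltration n ≤ ‹MeasurableSpace Ω› := iSup_le fun n => (hT.cylFiltration).le n
  refine Integrable.ae_eq_of_forall_setIntegral_eq _ _ integrable_condExp hh fun t ht _ => ?_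
  obtain ⟨s, hs, hts⟩ := hT.generator.2 t ht
  have hs' : MeasurableSet[⨆ n, hT.cylFiltration n] s := by
    refine MeasurableSpace.generateFrom_le ?_ s hs
    rintro _ ⟨n, a, ha, rfl⟩
    exact le_iSup (fun n => (hT.cylFiltration n)) (n + 1) _
      (MeasurableSpace.measurableSet_generateFrom ⟨n, n.lt_succ_self, a, ha, rfl⟩)
  rw [setIntegral_congr_set hts, setIntegral_congr_set hts, setIntegral_condExp hle hh hs']

theorem tendsto_measure_condExp_cylFiltration [IsProbabilityMeasure μ]
    (hT : IsGibbsMarkov μ α T r) {h : Ω → ℝ} (hh : Integrable h μ) {δ : ℝ} (hδ : 0 < δ) :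
    Tendsto (fun n => μ {x | δ ≤ ‖(μ[h | hT.cylFiltration n]) x - h x‖}) atTop (𝓝 0) := by
  refine (tendstoInMeasure_iff_norm.1 (tendstoInMeasure_of_tendsto_ae (fun n => ?_) ?_)) δ hδ
  · exact (stronglyMeasurable_condExp.mono ((hT.cylFiltration).le n)).aestronglyMeasurable
  · filter_upwards [tendsto_ae_condExp (ℱ := hT.cylFiltration) (μ := μ) h,
      hT.condExp_iSup_cylFiltration hh] with x hx hx'
    rwa [hx'] at hx

/-- For every bounded measurable function and every `a ∈ α` there is a cylinder that ends with
`a` on most of which the function is nearly constant. -/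
theorem exists_cyl_nearly_const [IsProbabilityMeasure μ] (hT : IsGibbsMarkov μ α T r)
    (hμ : MeasurePreserving T μ μ) {g : Ω → ℂ} (hg : Measurable g) (hg1 : ∀ x, ‖g x‖ ≤ 1)
    {a : Set Ω} (ha : a ∈ α) {δ : ℝ} (hδ : 0 < δ) {ε : ℝ≥0∞} (hε : ε ≠ 0) :
    ∃ (n : ℕ) (w : Fin (n + 1) → Set Ω), (∀ i, w i ∈ α) ∧ w (Fin.last n) = a ∧
      μ (cyl T w) ≠ 0 ∧ ∃ q : ℂ, μ (cyl T w ∩ {x | δ ≤ ‖g x - q‖}) ≤ ε * μ (cyl T w) := by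
  have hint : Integrable g μ :=
    Integrable.of_bound hg.aestronglyMeasurable 1 (Eventually.of_forall hg1)
  have hδ2 : 0 < δ / 2 := by positivity
  have hre := hT.tendsto_measure_condExp_cylFiltration (h := fun x => (g x).re) hint.re hδ2
  have him := hT.tendsto_measure_condExp_cylFiltration (h := fun x => (g x).im) hint.im hδ2
  have hsum := hre.add him
  rw [add_zero] at hsum
  have hpos : 0 < ε * μ a := ENNReal.mul_pos hε (hT.measure_pos ha).ne'
  obtain ⟨n, hn, hn1⟩ := ((hsum.eventually (gt_mem_nhds hpos)).and (eventually_ge_atTop 1)).exists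
  obtain ⟨n, rfl⟩ := Nat.exists_eq_add_of_le' hn1
  set φ : Ω → ℂ := fun x => ((μ[fun x => (g x).re | hT.cylFiltration (n + 1)]) x : ℂ) +
    ((μ[fun x => (g x).im | hT.cylFiltration (n + 1)]) x : ℂ) * Complex.I with hφ
  have hφm : Measurable[hT.cylFiltration (n + 1)] φ := by
    have h1 := (stronglyMeasurable_condExp (μ := μ) (m := hT.cylFiltration (n + 1))
      (f := fun x => (g x).re)).measurable
    have h2 := (stronglyMeasurable_condExp (μ := μ) (m := hT.cylFiltration (n + 1))
      (f := fun x => (g x).im)).measurable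
    exact (Complex.measurable_ofReal.comp h1).add
      ((Complex.measurable_ofReal.comp h2).mul_const _)
  set B : Set Ω := {x | δ ≤ ‖g x - φ x‖} with hB
  have hBm : MeasurableSet B :=
    measurableSet_le measurable_const (hg.sub (hφm.mono ((hT.cylFiltration).le _) le_rfl)).norm
  have hBlt : μ B < ε * μ a := by
    refine lt_of_le_of_lt ((measure_mono ?_).trans (measure_union_le _ _)) hn
    intro x hx
    simp only [mem_union, mem_ofPred_eq]
    by_contra! hcon
    have h1 : g x - φ x = -((((μ[fun x => (g x).re | hT.cylFiltration (n + 1)]) x - (g x).re : ℝ) : ℂ)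
        + (((μ[fun x => (g x).im | hT.cylFiltration (n + 1)]) x - (g x).im : ℝ) : ℂ) * Complex.I) := by
      simp only [hφ]
      conv_lhs => rw [← Complex.re_add_im (g x)]
      push_cast
      ring
    have h2 : ‖g x - φ x‖ < δ := by
      rw [h1, norm_neg]
      refine (norm_add_le _ _).trans_lt ?_
      rw [norm_mul, Complex.norm_I, mul_one, Complex.norm_real, Complex.norm_real]
      linarith [hcon.1, hcon.2]
    exact absurd hx (not_le.2 h2)
  -- If `g` were far from `φ z`, the constant value of `φ`, on a proportion above `ε` of every
  -- positive-measure cylinder ending in `a`, summing over these disjoint cylinders would give `μ B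
  -- ≥ ε * μ a`.
  by_contra! hcon
  have := hT.partition.countable.to_subtype
  let W : (Fin n → α) → (Fin (n + 1) → Set Ω) := fun v => Fin.snoc (fun i => (v i : Set Ω)) a
  have hWmem : ∀ v i, W v i ∈ α := fun v i => by
    refine Fin.lastCases ?_ (fun j => ?_) i
    · simpa [W] using ha
    · simp [W]
  have hWlast : ∀ v, W v (Fin.last n) = a := fun v => by simp [W]
  have hWinj : Function.Injective W := fun v v' h => by
    funext i
    have := congrFun h i.castSucc
    simpa [W, Subtype.ext_iff] using this
  have hcm : ∀ v, MeasurableSet (cyl T (W v)) := fun v =>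
    measurableSet_cyl hT.measurable fun i => hT.partition.measurableSet _ (hWmem v i)
  have hdisj : Pairwise (Function.onFun Disjoint fun v => cyl T (W v)) := fun v v' hne =>
    Set.disjoint_left.2 fun x hx hx' => hne (hWinj
      (word_eq_of_mem_cyl hT.partition (hWmem v) (hWmem v') hx hx'))
  have hle : ∀ v, ε * μ (cyl T (W v)) ≤ μ (cyl T (W v) ∩ B) := fun v => by
    rcases eq_or_ne (μ (cyl T (W v))) 0 with h0 | h0
    · simp [h0]
    · obtain ⟨z, hz⟩ := nonempty_of_measure_ne_zero h0
      refine (hcon n (W v) (hWmem v) (hWlast v) h0 (φ z)).le.trans (measure_mono ?_)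
      rintro x ⟨hx, hx'⟩
      refine ⟨hx, ?_⟩
      rw [mem_ofPred_eq, ← hT.eq_of_mem_cyl hφm (hWmem v) hx hz] at hx'
      exact hx'
  -- The cylinders of length `n + 1` ending in `a` fill `T^(-n) a`, which has measure `μ a` by
  -- invariance.
  have hcover : μ a ≤ μ (⋃ v, cyl T (W v)) := by
    rw [← (hμ.iterate n).measure_preimage (hT.partition.measurableSet a ha).nullMeasurableSet]
    refine measure_mono_ae ?_
    filter_upwards [hT.ae_mem] with x hx hxa
    choose u hu hxu using hx
    refine mem_iUnion.2 ⟨fun i => ⟨u i, hu i⟩, mem_cyl.2 fun i => ?_⟩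
    refine Fin.lastCases ?_ (fun j => ?_) i
    · have : T^[n] x ∈ a := hxa
      simpa [W] using this
    · simpa [W] using hxu j
  refine absurd hBlt (not_lt.2 ?_)
  calc ε * μ a ≤ ε * μ (⋃ v, cyl T (W v)) := by gcongr
    _ = ∑' v, ε * μ (cyl T (W v)) := by rw [measure_iUnion hdisj hcm, ENNReal.tsum_mul_left]
    _ ≤ ∑' v, μ (cyl T (W v) ∩ B) := ENNReal.tsum_le_tsum hle
    _ = μ (⋃ v, cyl T (W v) ∩ B) := by
        rw [measure_iUnion (fun v v' hne => (hdisj hne).mono inter_subset_left inter_subset_left)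
          fun v => (hcm v).inter hBm]
    _ ≤ μ B := measure_mono (iUnion_subset fun v => inter_subset_right)

end IsGibbsMarkov

/-! ### Oscillation of Birkhoff sums -/

theorem norm_exp_I_mul_sub_le (s t : ℝ) :
    ‖Complex.exp (Complex.I * s) - Complex.exp (Complex.I * t)‖ ≤ |s - t| := by
  have h : Complex.exp (Complex.I * s) - Complex.exp (Complex.I * t) =
      Complex.exp (Complex.I * t) * (Complex.exp (Complex.I * (s - t : ℝ)) - 1) := by
    rw [mul_sub, ← Complex.exp_add, mul_one]
    congr 2
    push_cast
    ring
  rw [h, norm_mul, Complex.norm_exp_I_mul_ofReal, one_mul]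
  exact Real.norm_exp_I_mul_ofReal_sub_one_le

theorem iterate_mem_cyl {T : Ω → Ω} {n j : ℕ} {w : Fin n → Set Ω} {d : Fin j → Set Ω} {x : Ω}
    (hx : x ∈ cyl T w) (hx' : T^[n] x ∈ cyl T d) {i : ℕ} (hi : i < n + j) :
    T^[i] x ∈ if h : i < n then w ⟨i, h⟩ else d ⟨i - n, by omega⟩ := by
  split_ifs with h
  · exact mem_cyl.1 hx ⟨i, h⟩
  · have := mem_cyl.1 hx' ⟨i - n, by omega⟩
    rwa [← Function.iterate_add_apply, Nat.sub_add_cancel (not_lt.1 h)] at this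

/-- At time `i` the orbits still agree for `n + j - i` steps, so the differences are dominated by a
geometric progression whose sum does not depend on `n`. -/
theorem abs_birkhoffSum_sub_le [MeasurableSpace Ω] {μ : Measure Ω} {α : Set (Set Ω)}
    (hα : IsPartitionMod μ α) {T : Ω → Ω} {r : ℝ} (hr : 0 < r) (hr1 : r < 1)
    {f : Ω → ℝ} {D : ℝ} (hD : 0 ≤ D)
    (hf : ∀ a ∈ α, ∀ x ∈ a, ∀ y ∈ a, |f x - f y| ≤ D * symDist α T r x y)
    {n j : ℕ} {w : Fin n → Set Ω} (hw : ∀ i, w i ∈ α) {d : Fin j → Set Ω} (hd : ∀ i, d i ∈ α)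
    {x y : Ω} (hx : x ∈ cyl T w) (hx' : T^[n] x ∈ cyl T d) (hy : y ∈ cyl T w)
    (hy' : T^[n] y ∈ cyl T d) :
    |birkhoffSum T f n x - birkhoffSum T f n y| ≤ D / (1 - r) * r ^ j := by
  have hsep : ∀ i < n + j, ¬ Separated α (T^[i] x) (T^[i] y) := fun i hi => by
    refine not_separated_of_mem hα ?_ (iterate_mem_cyl hx hx' hi) (iterate_mem_cyl hy hy' hi)
    split_ifs
    · exact hw _
    · exact hd _
  have hterm : ∀ i ∈ Finset.range n,
      |f (T^[i] x) - f (T^[i] y)| ≤ D * r ^ j * r ^ (n - 1 - i) := fun i hi => by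
    have hi := Finset.mem_range.1 hi
    refine (hf _ (hw ⟨i, hi⟩) _ (mem_cyl.1 hx ⟨i, hi⟩) _ (mem_cyl.1 hy ⟨i, hi⟩)).trans ?_
    rw [mul_assoc, ← pow_add]
    refine mul_le_mul_of_nonneg_left (symDist_le hr hr1 fun l hl => ?_) hD
    rw [← Function.iterate_add_apply, ← Function.iterate_add_apply]
    exact hsep (l + i) (by omega)
  have hgeom : ∑ i ∈ Finset.range n, r ^ i ≤ (1 - r)⁻¹ := by
    rw [← tsum_geometric_of_lt_one hr.le hr1]
    exact (summable_geometric_of_lt_one hr.le hr1).sum_le_tsum _ fun i _ => by positivity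
  calc |birkhoffSum T f n x - birkhoffSum T f n y|
      = |∑ i ∈ Finset.range n, (f (T^[i] x) - f (T^[i] y))| := by
        rw [Finset.sum_sub_distrib]; rfl
    _ ≤ ∑ i ∈ Finset.range n, D * r ^ j * r ^ (n - 1 - i) :=
        (Finset.abs_sum_le_sum_abs _ _).trans (Finset.sum_le_sum hterm)
    _ = D * r ^ j * ∑ i ∈ Finset.range n, r ^ i := by
        rw [← Finset.mul_sum, Finset.sum_range_reflect (fun i => r ^ i)]
    _ ≤ D * r ^ j * (1 - r)⁻¹ := by gcongr
    _ = D / (1 - r) * r ^ j := by ring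

/-! ### Regularity of transfer functions -/

namespace IsGibbsMarkov

variable [MeasurableSpace Ω] {μ : Measure Ω} {α : Set (Set Ω)} {T : Ω → Ω} {r : ℝ}

theorem ae_eq_exp_birkhoffSum_mul (hT : IsGibbsMarkov μ α T r) {f : Ω → ℝ} {κ : ℝ} {g : Ω → ℂ}
    (hfg : ∀ᵐ x ∂μ, g x = Complex.exp (Complex.I * (κ * f x : ℝ)) * g (T x)) :
    ∀ᵐ x ∂μ, ∀ n : ℕ,
      g x = Complex.exp (Complex.I * (κ * birkhoffSum T f n x : ℝ)) * g (T^[n] x) := by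
  have h : ∀ᵐ x ∂μ, ∀ i : ℕ, g (T^[i] x) =
      Complex.exp (Complex.I * (κ * f (T^[i] x) : ℝ)) * g (T (T^[i] x)) :=
    ae_all_iff.2 fun i => (hT.quasiMeasurePreserving.iterate i).ae hfg
  filter_upwards [h] with x hx n
  induction n with
  | zero => simp
  | succ n ih =>
    rw [ih, hx n, ← mul_assoc, ← Complex.exp_add, birkhoffSum_succ, Function.iterate_succ_apply']
    congr 2
    push_cast
    ring

/-- Near-constancy of `g` on a long cylinder ending in `a` is transported to `T '' a` by the cocycle
relation. The phase varies little over the points landing in `cyl T d`, and distortion costs only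
the factor `C`, whence the tolerance `η / C` upstairs. -/
theorem exists_measure_far_le [IsProbabilityMeasure μ] (hT : IsGibbsMarkov μ α T r)
    (hμ : MeasurePreserving T μ μ) {f : Ω → ℝ} {D : ℝ} (hD : 0 ≤ D)
    (hf : ∀ a ∈ α, ∀ x ∈ a, ∀ y ∈ a, |f x - f y| ≤ D * symDist α T r x y)
    {κ : ℝ} {g : Ω → ℂ} (hg : Measurable g) (hg1 : ∀ x, ‖g x‖ ≤ 1)
    (hfg : ∀ᵐ x ∂μ, g x = Complex.exp (Complex.I * (κ * f x : ℝ)) * g (T x))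
    {a : Set Ω} (ha : a ∈ α) {j : ℕ} {d : Fin j → Set Ω} (hd : ∀ i, d i ∈ α)
    {δ : ℝ} (hδ : 0 < δ) {η : ℝ≥0∞} (hη : η ≠ 0) :
    ∃ q : ℂ, μ ((cyl T d ∩ {x | |κ| * (D / (1 - r) * r ^ j) + δ ≤ ‖g x - q‖}) ∩ T '' a) ≤ η := by
  obtain ⟨C, hC0, hCtop, hC⟩ := hT.exists_measure_inter_image_mul_le
  obtain ⟨n, w, hw, rfl, hpos, q, hq⟩ := hT.exists_cyl_nearly_const hμ hg hg1 ha hδ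
    (ENNReal.div_pos hη hCtop).ne'
  have hdm : MeasurableSet (cyl T d) :=
    measurableSet_cyl hT.measurable fun i => hT.partition.measurableSet _ (hd i)
  suffices h : ∃ q' : ℂ, μ (cyl T w ∩ T^[n + 1] ⁻¹'
      (cyl T d ∩ {x | |κ| * (D / (1 - r) * r ^ j) + δ ≤ ‖g x - q'‖})) ≤ η / C * μ (cyl T w) by
    obtain ⟨q', hq'⟩ := h
    refine ⟨q', ?_⟩
    have h1 := hC n w hw (cyl T d ∩ {x | |κ| * (D / (1 - r) * r ^ j) + δ ≤ ‖g x - q'‖})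
      (hdm.inter (measurableSet_le measurable_const (hg.sub_const _).norm))
    have h2 : C * (η / C * μ (cyl T w)) = η * μ (cyl T w) := by
      rw [← mul_assoc, ENNReal.mul_div_cancel hC0 hCtop]
    have h3 := h1.trans (mul_le_mul_right hq' C)
    rw [h2] at h3
    exact (ENNReal.mul_le_mul_iff_left hpos (measure_ne_top μ _)).1 h3
  by_cases hne : ∃ z, z ∈ cyl T w ∧ T^[n + 1] z ∈ cyl T d
  · obtain ⟨z, hzw, hzd⟩ := hne
    -- The new centre is `q` rotated by the phase of one reference point `z`; every other phase
    -- differs from it by at most `|κ| * (D / (1 - r) * r ^ j)`.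
    refine ⟨Complex.exp (Complex.I * (-(κ * birkhoffSum T f (n + 1) z) : ℝ)) * q,
      (measure_mono_ae ?_).trans hq⟩
    filter_upwards [hT.ae_eq_exp_birkhoffSum_mul hfg] with x hx hxm
    obtain ⟨hxw, hxd, hxq⟩ := hxm
    refine ⟨hxw, ?_⟩
    have hb := abs_birkhoffSum_sub_le hT.partition hT.r_pos hT.r_lt_one hD hf hw hd hxw hxd hzw hzd
    have hgx : g (T^[n + 1] x) =
        Complex.exp (Complex.I * (-(κ * birkhoffSum T f (n + 1) x) : ℝ)) * g x := by
      conv_rhs => rw [hx (n + 1), ← mul_assoc, ← Complex.exp_add]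
      push_cast
      simp
    have hle : ‖g (T^[n + 1] x) -
        Complex.exp (Complex.I * (-(κ * birkhoffSum T f (n + 1) z) : ℝ)) * q‖ ≤
        |κ| * (D / (1 - r) * r ^ j) + ‖g x - q‖ := by
      have h1 := norm_exp_I_mul_sub_le (-(κ * birkhoffSum T f (n + 1) x))
        (-(κ * birkhoffSum T f (n + 1) z))
      have h2 : |-(κ * birkhoffSum T f (n + 1) x) - -(κ * birkhoffSum T f (n + 1) z)| =
          |κ| * |birkhoffSum T f (n + 1) x - birkhoffSum T f (n + 1) z| := by
        rw [← abs_mul, ← abs_neg]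
        congr 1
        ring
      have h3 : ∀ u v : ℂ, u * g x - v * q = (u - v) * g x + v * (g x - q) := fun u v => by ring
      rw [hgx, h3]
      refine (norm_add_le _ _).trans (add_le_add ?_ ?_)
      · rw [norm_mul]
        refine (mul_le_of_le_one_right (norm_nonneg _) (hg1 x)).trans ((h1.trans h2.le).trans ?_)
        exact mul_le_mul_of_nonneg_left hb (abs_nonneg κ)
      · rw [norm_mul, Complex.norm_exp_I_mul_ofReal, one_mul]
    have hxq' : |κ| * (D / (1 - r) * r ^ j) + δ ≤ ‖g (T^[n + 1] x) -
        Complex.exp (Complex.I * (-(κ * birkhoffSum T f (n + 1) z) : ℝ)) * q‖ := hxq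
    have : δ ≤ ‖g x - q‖ := by linarith
    exact this
  · refine ⟨0, ?_⟩
    refine (measure_mono_null (t := ∅) (fun x hx => ?_) measure_empty).le.trans zero_le
    exact hne ⟨x, hx.1, hx.2.1⟩

/-- The regularity of transfer functions: if `g = exp(i κ f) g ∘ T` with `f` locally Lipschitz,
then `g` is Lipschitz, modulo `μ`, on the image of every member of the partition. -/
theorem ae_norm_sub_le [IsProbabilityMeasure μ] (hT : IsGibbsMarkov μ α T r)
    (hμ : MeasurePreserving T μ μ) {f : Ω → ℝ} {D : ℝ} (hD : 0 ≤ D)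
    (hf : ∀ a ∈ α, ∀ x ∈ a, ∀ y ∈ a, |f x - f y| ≤ D * symDist α T r x y)
    {κ : ℝ} {g : Ω → ℂ} (hg : Measurable g) (hg1 : ∀ x, ‖g x‖ ≤ 1)
    (hfg : ∀ᵐ x ∂μ, g x = Complex.exp (Complex.I * (κ * f x : ℝ)) * g (T x))
    {a : Set Ω} (ha : a ∈ α) {j : ℕ} {d : Fin j → Set Ω} (hd : ∀ i, d i ∈ α) :
    ∀ᵐ x ∂μ, ∀ᵐ y ∂μ, x ∈ T '' a → x ∈ cyl T d → y ∈ T '' a → y ∈ cyl T d →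
      ‖g x - g y‖ ≤ 2 * (|κ| * (D / (1 - r) * r ^ j)) := by
  set K := |κ| * (D / (1 - r) * r ^ j) with hK
  refine Measure.ae_ae_of_ae_prod (p := fun z : Ω × Ω => z.1 ∈ T '' a → z.1 ∈ cyl T d →
    z.2 ∈ T '' a → z.2 ∈ cyl T d → ‖g z.1 - g z.2‖ ≤ 2 * K) ?_
  -- The centre `q` depends on `η`, but the bound on pairs does not mention it: a bad pair has a
  -- coordinate in `F`, so bad pairs have measure at most `η` for every `η > 0`. Afterwards `m → ∞`
  -- removes the slack.
  have key : ∀ m : ℕ, ∀ᵐ z ∂(μ.prod μ), z.1 ∈ T '' a → z.1 ∈ cyl T d →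
      z.2 ∈ T '' a → z.2 ∈ cyl T d → ‖g z.1 - g z.2‖ ≤ 2 * (K + 1 / ((m : ℝ) + 1)) := fun m => by
    have hδ : (0 : ℝ) < 1 / ((m : ℝ) + 1) := by positivity
    rw [ae_iff]
    refine le_antisymm (ENNReal.le_of_forall_pos_le_add fun η hη _ => ?_) zero_le
    rw [zero_add]
    have hη2 : (η / 2 : ℝ≥0∞) ≠ 0 := (ENNReal.div_pos (by exact_mod_cast hη.ne') (by simp)).ne'
    obtain ⟨q, hq⟩ := hT.exists_measure_far_le hμ hD hf hg hg1 hfg ha hd hδ hη2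
    rw [← hK] at hq
    set F := (cyl T d ∩ {x | K + 1 / ((m : ℝ) + 1) ≤ ‖g x - q‖}) ∩ T '' a with hF
    calc (μ.prod μ) _ ≤ (μ.prod μ) (F ×ˢ univ ∪ univ ×ˢ F) := measure_mono ?_
      _ ≤ (μ.prod μ) (F ×ˢ univ) + (μ.prod μ) (univ ×ˢ F) := measure_union_le _ _
      _ ≤ η / 2 + η / 2 := by
        rw [Measure.prod_prod, Measure.prod_prod, measure_univ, one_mul, mul_one]
        exact add_le_add hq hq
      _ = η := ENNReal.add_halves _
    rintro ⟨x, y⟩ hxy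
    simp only [mem_ofPred_eq, Classical.not_imp, not_le] at hxy
    obtain ⟨hxa, hxd, hya, hyd, hlt⟩ := hxy
    by_contra hcon
    have hx : ‖g x - q‖ < K + 1 / ((m : ℝ) + 1) :=
      not_le.1 fun h => hcon (Or.inl ⟨⟨⟨hxd, h⟩, hxa⟩, trivial⟩)
    have hy : ‖g y - q‖ < K + 1 / ((m : ℝ) + 1) :=
      not_le.1 fun h => hcon (Or.inr ⟨trivial, ⟨⟨hyd, h⟩, hya⟩⟩)
    have h3 := norm_sub_le_norm_sub_add_norm_sub (g x) q (g y)
    rw [norm_sub_rev q] at h3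
    linarith
  filter_upwards [ae_all_iff.2 key] with z hz h1 h2 h3 h4
  have hlim : Tendsto (fun m : ℕ => 2 * (K + 1 / ((m : ℝ) + 1))) atTop (𝓝 (2 * (K + 0))) :=
    (tendsto_one_div_add_atTop_nhds_zero_nat.const_add K).const_mul 2
  rw [add_zero] at hlim
  exact ge_of_tendsto' hlim fun m => hz m h1 h2 h3 h4

end IsGibbsMarkov

/-! ### Partitions modulo `μ` and the image partition -/

section Partition

variable [MeasurableSpace Ω] {μ : Measure Ω}

theorem exists_ae_eq_of_generateFrom {C : Set (Set Ω)} {m : MeasurableSpace Ω}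
    (h : ∀ t ∈ C, ∃ u, MeasurableSet[m] u ∧ t =ᵐ[μ] u) {s : Set Ω}
    (hs : MeasurableSet[MeasurableSpace.generateFrom C] s) :
    ∃ u, MeasurableSet[m] u ∧ s =ᵐ[μ] u := by
  induction s, hs using MeasurableSpace.generateFrom_induction with
  | hC t ht _ => exact h t ht
  | empty => exact ⟨∅, MeasurableSet.empty, ae_eq_refl _⟩
  | compl t _ ih =>
    obtain ⟨u, hu, htu⟩ := ih
    exact ⟨uᶜ, hu.compl, htu.compl⟩
  | iUnion s _ ih =>
    choose u hu hsu using ih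
    exact ⟨⋃ i, u i, MeasurableSet.iUnion hu, Filter.EventuallyEq.countable_iUnion hsu⟩

theorem measurableMod_of_ae_const {γ : Set (Set Ω)} (hγ : IsPartitionMod μ γ) {E : Type*}
    [MeasurableSpace E] [Inhabited E] {h : Ω → E}
    (hc : ∀ c ∈ γ, ∃ q, ∀ᵐ x ∂μ, x ∈ c → h x = q) : MeasurableMod μ γ h := by
  classical
  choose! q hq using hc
  let h' : Ω → E := fun x => if hx : ∃ c ∈ γ, x ∈ c then q hx.choose else default
  have hval : ∀ c ∈ γ, ∀ x ∈ c, h' x = q c := fun c hc x hx => by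
    have hx' : ∃ c ∈ γ, x ∈ c := ⟨c, hc, hx⟩
    have : hx'.choose = c := by
      by_contra hne
      exact Set.disjoint_left.1 (hγ.disjoint _ hx'.choose_spec.1 c hc hne) hx'.choose_spec.2 hx
    simp only [h', dif_pos hx', this]
  have hdef : ∀ x, x ∉ ⋃₀ γ → h' x = default := fun x hx => dif_neg fun ⟨c, hc, hxc⟩ =>
    hx ⟨c, hc, hxc⟩
  have hU : MeasurableSet[MeasurableSpace.generateFrom γ] (⋃₀ γ) :=
    MeasurableSet.sUnion hγ.countable fun c hc => MeasurableSpace.measurableSet_generateFrom hc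
  refine ⟨h', fun t _ => ?_, ?_⟩
  · have heq : h' ⁻¹' t = ⋃₀ {c ∈ γ | q c ∈ t} ∪ ((⋃₀ γ)ᶜ ∩ {_x | default ∈ t}) := by
      ext x
      by_cases hx : x ∈ ⋃₀ γ
      · obtain ⟨c, hc, hxc⟩ := hx
        have hx : x ∈ ⋃₀ γ := ⟨c, hc, hxc⟩
        simp only [mem_preimage, hval c hc x hxc, mem_union, mem_inter_iff, mem_compl_iff, hx,
          not_true_eq_false, false_and, or_false]
        refine ⟨fun h => ⟨c, ⟨hc, h⟩, hxc⟩, ?_⟩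
        rintro ⟨c', ⟨hc', h⟩, hxc'⟩
        rwa [← hval c hc x hxc, hval c' hc' x hxc']
      · have hx' : x ∉ ⋃₀ {c ∈ γ | q c ∈ t} := fun ⟨c, hc, hxc⟩ => hx ⟨c, hc.1, hxc⟩
        simp [hdef x hx, hx, hx']
    rw [heq]
    refine MeasurableSet.union (MeasurableSet.sUnion (hγ.countable.mono (sep_subset _ _))
      fun c hc => MeasurableSpace.measurableSet_generateFrom hc.1) (hU.compl.inter ?_)
    exact MeasurableSet.const _
  · have h1 : ∀ᵐ x ∂μ, ∀ c ∈ γ, x ∈ c → h x = q c := (ae_ball_iff hγ.countable).2 hq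
    have h2 : ∀ᵐ x ∂μ, x ∈ ⋃₀ γ := by
      rw [ae_iff]; exact hγ.cover
    filter_upwards [h1, h2] with x hx ⟨c, hc, hxc⟩
    rw [hx c hc hxc, hval c hc x hxc]

end Partition

namespace IsGibbsMarkov

variable [MeasurableSpace Ω] {μ : Measure Ω} {α : Set (Set Ω)} {T : Ω → Ω} {r : ℝ}

/-- Almost every point lies in some `b ∈ α`, so otherwise `T ⁻¹' a` would be null, against
non-singularity. -/
theorem exists_measure_inter_image_ne_zero (hT : IsGibbsMarkov μ α T r) {a : Set Ω}
    (ha : a ∈ α) : ∃ b ∈ α, μ (a ∩ T '' b) ≠ 0 := by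
  by_contra! hcon
  refine (hT.measure_pos ha).ne' ((hT.nonsingular a (hT.partition.measurableSet a ha)).1 ?_)
  have h1 : ∀ᵐ x ∂μ, ∀ b ∈ α, T x ∉ a ∩ T '' b := (ae_ball_iff hT.partition.countable).2
    fun b hb => measure_eq_zero_iff_ae_notMem.1
      (hT.quasiMeasurePreserving.preimage_null (hcon b hb))
  rw [measure_eq_zero_iff_ae_notMem]
  filter_upwards [h1, hT.ae_mem] with x hx hx' hxa
  obtain ⟨b, hb, hxb⟩ := hx' 0
  exact hx b hb ⟨hxa, x, hxb, rfl⟩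

/-- The `σ`-algebra generated by the images of the members of the partition is generated, modulo
`μ`, by a finest partition, each of whose members lies in one of the images. -/
theorem exists_isImagePartition (hT : IsGibbsMarkov μ α T r) :
    ∃ β, IsImagePartition μ α T β ∧ ∀ b ∈ β, ∃ a ∈ α, μ (b \ T '' a) = 0 := by
  classical
  have hα := hT.partition
  choose! S hS hTS using hT.markov
  have hmem : ∀ a ∈ α, ∀ x ∈ a, ∀ b ∈ α, (x ∈ S b ↔ a ⊆ S b) := fun a ha x hx b hb =>
    ⟨fun h y hy => (mem_iff_of_generateFrom
      (fun t ht => mem_iff_of_mem_partition hα ha hx hy ht) (hS b hb)).1 h, fun h => h hx⟩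
  -- `B a` is the atom containing `a` of the `σ`-algebra generated by the sets `S b`. Indexing atoms
  -- by `α` keeps them countable in number; any other atom misses `⋃₀ α`.
  let B : Set Ω → Set Ω := fun a => {x | ∀ b ∈ α, (x ∈ S b ↔ a ⊆ S b)}
  have hB : ∀ a, B a = ⋂ b ∈ α, if a ⊆ S b then S b else (S b)ᶜ := fun a => by
    ext x
    simp only [B, mem_ofPred_eq, mem_iInter]
    refine forall₂_congr fun b _ => ?_
    split_ifs with h <;> simp [h]
  have hsub : ∀ a ∈ α, a ⊆ B a := fun a ha x hx b hb => hmem a ha x hx b hb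
  have hpart : IsPartitionMod μ (B '' α) := by
    refine ⟨hα.countable.image B, ?_, ?_, ?_⟩
    · rintro _ ⟨a, -, rfl⟩
      rw [hB]
      refine MeasurableSet.biInter hα.countable fun b hb => ?_
      have := hT.measurableSet_of_generateFrom (hS b hb)
      split_ifs
      · exact this
      · exact this.compl
    · rintro _ ⟨a, -, rfl⟩ _ ⟨a', -, rfl⟩ hne
      refine Set.disjoint_left.2 fun x hx hx' => hne ?_
      ext y
      refine forall₂_congr fun b hb => ?_
      rw [← hx b hb, ← hx' b hb]
    · refine measure_mono_null (compl_subset_compl.2 ?_) hα.cover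
      rintro x ⟨a, ha, hx⟩
      exact ⟨B a, ⟨a, ha, rfl⟩, hsub a ha hx⟩
  have hcover : ∀ᵐ x ∂μ, x ∈ ⋃₀ α := by
    rw [ae_iff]; exact hα.cover
  have hgen : GeneratesImage μ α T (B '' α) := by
    refine ⟨hpart, fun s hs => exists_ae_eq_of_generateFrom ?_ hs,
      fun s hs => exists_ae_eq_of_generateFrom ?_ hs⟩
    · rintro _ ⟨b, hb, rfl⟩
      refine ⟨⋃₀ (B '' {a ∈ α | a ⊆ S b}), MeasurableSet.sUnion
        ((hα.countable.mono (sep_subset _ _)).image B) ?_, (hTS b hb).trans ?_⟩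
      · rintro _ ⟨a, ha, rfl⟩
        exact MeasurableSpace.measurableSet_generateFrom ⟨a, ha.1, rfl⟩
      · filter_upwards [hcover] with x ⟨a, ha, hxa⟩
        refine propext ⟨fun (hx : x ∈ S b) => ?_, ?_⟩
        · exact ⟨B a, ⟨a, ⟨ha, (hmem a ha x hxa b hb).1 hx⟩, rfl⟩, hsub a ha hxa⟩
        · rintro ⟨_, ⟨a', ha', rfl⟩, hx⟩
          exact (hx b hb).2 ha'.2
    · rintro _ ⟨a, -, rfl⟩
      refine ⟨⋂ b ∈ α, if a ⊆ S b then T '' b else (T '' b)ᶜ,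
        MeasurableSet.biInter hα.countable fun b hb => ?_, ?_⟩
      · have : MeasurableSet[MeasurableSpace.generateFrom ((fun a => T '' a) '' α)] (T '' b) :=
          MeasurableSpace.measurableSet_generateFrom ⟨b, hb, rfl⟩
        split_ifs
        · exact this
        · exact this.compl
      · rw [hB]
        refine Filter.EventuallyEq.countable_bInter hα.countable fun b hb => ?_
        split_ifs
        · exact (hTS b hb).symm
        · exact (hTS b hb).symm.compl
  refine ⟨B '' α, ⟨hgen, ?_⟩, ?_⟩
  · rintro γ ⟨hγ, hγ1, hγ2⟩ _ ⟨a, ha, rfl⟩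
    have hpos : μ (B a) ≠ 0 := ((hT.measure_pos ha).trans_le (measure_mono (hsub a ha))).ne'
    -- Some `c ∈ γ` meets the atom in positive measure; being a.e. equal to a set of `σ(B '' α)`, it
    -- contains the whole atom mod `μ`.
    obtain ⟨c, hc, hac⟩ : ∃ c ∈ γ, μ (B a ∩ c) ≠ 0 := by
      by_contra! hcon
      refine hpos (measure_mono_null ?_ (measure_union_null
        ((measure_biUnion_null_iff hγ.countable).2 hcon) hγ.cover))
      intro x hx
      by_cases hxγ : x ∈ ⋃₀ γ
      · obtain ⟨c, hc, hxc⟩ := hxγ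
        exact Or.inl (mem_iUnion₂.2 ⟨c, hc, hx, hxc⟩)
      · exact Or.inr hxγ
    refine ⟨c, hc, ?_⟩
    obtain ⟨s, hs, hcs⟩ := hγ2 c (MeasurableSpace.measurableSet_generateFrom hc)
    obtain ⟨t, ht, hst⟩ := hgen.2.1 s hs
    have hct := hcs.trans hst
    rw [measure_congr ((ae_eq_refl (B a)).inter hct)] at hac
    obtain ⟨x, hxa, hxt⟩ := nonempty_of_measure_ne_zero hac
    have : B a \ t = ∅ := Set.sdiff_eq_empty.2 fun y hy =>
      (mem_iff_of_generateFrom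
        (fun u hu => mem_iff_of_mem_partition hpart ⟨a, ha, rfl⟩ hxa hy hu) ht).1 hxt
    rw [measure_congr ((ae_eq_refl (B a)).diff hct), this, measure_empty]
  · rintro _ ⟨a, ha, rfl⟩
    obtain ⟨b, hb, hab⟩ := hT.exists_measure_inter_image_ne_zero ha
    refine ⟨b, hb, ?_⟩
    rw [measure_congr ((ae_eq_refl a).inter (hTS b hb))] at hab
    obtain ⟨x, hxa, hxb⟩ := nonempty_of_measure_ne_zero hab
    have : B a \ S b = ∅ := Set.sdiff_eq_empty.2 fun y hy =>
      (hy b hb).2 ((hmem a ha x hxa b hb).1 hxb)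
    rw [measure_congr ((ae_eq_refl (B a)).diff (hTS b hb)), this, measure_empty]

end IsGibbsMarkov

/-! ### Reduction to bounded transfer functions -/

/-- A rotation-equivariant embedding of the plane into the unit disc. -/
noncomputable def discEmbed (z : ℂ) : ℂ := z / ((1 + ‖z‖ : ℝ) : ℂ)

theorem norm_discEmbed (z : ℂ) : ‖discEmbed z‖ = ‖z‖ / (1 + ‖z‖) := by
  rw [discEmbed, norm_div, Complex.norm_real, Real.norm_of_nonneg (by positivity)]

theorem norm_discEmbed_le_one (z : ℂ) : ‖discEmbed z‖ ≤ 1 := by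
  rw [norm_discEmbed]
  exact (div_le_one (by positivity)).2 (by linarith [norm_nonneg z])

theorem measurable_discEmbed : Measurable discEmbed := by
  unfold discEmbed; fun_prop

theorem discEmbed_mul {u : ℂ} (hu : ‖u‖ = 1) (z : ℂ) : discEmbed (u * z) = u * discEmbed z := by
  rw [discEmbed, discEmbed, norm_mul, hu, one_mul, mul_div_assoc]

theorem one_add_norm_ne_zero (z : ℂ) : ((1 + ‖z‖ : ℝ) : ℂ) ≠ 0 :=
  Complex.ofReal_ne_zero.2 (by positivity)

theorem discEmbed_ne_zero {z : ℂ} (hz : z ≠ 0) : discEmbed z ≠ 0 :=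
  div_ne_zero hz (one_add_norm_ne_zero z)

theorem discEmbed_injective : Function.Injective discEmbed := fun z w h => by
  have hn : ‖z‖ = ‖w‖ := by
    have h1 := congrArg norm h
    rw [norm_discEmbed, norm_discEmbed, div_eq_div_iff (by positivity) (by positivity)] at h1
    linarith
  rw [discEmbed, discEmbed, hn] at h
  exact (div_left_inj' (one_add_norm_ne_zero w)).1 h

/-- Leaving `a` at a time `i < n` separates the orbit from the fixed point, forcing a distance of at
least `r ^ (i + 1) ≥ r ^ n`. -/
theorem mem_cyl_of_mem_symBall {α : Set (Set Ω)}
    {T : Ω → Ω} {r : ℝ} (hr : 0 < r) (hr1 : r < 1) {a : Set Ω} (ha : a ∈ α) {p : Ω} (hp : p ∈ a)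
    (hTp : T p = p) {n : ℕ} {x : Ω} (hx : x ∈ symBall α T r p (r ^ n)) :
    x ∈ cyl T fun _ : Fin n => a := by
  classical
  refine mem_cyl.2 fun i => ?_
  by_contra hcon
  have hfix : T^[(i : ℕ)] p = p := Function.iterate_fixed hTp i
  have hsep : Separated α (T^[(i : ℕ)] x) (T^[(i : ℕ)] p) :=
    ⟨a, ha, by simp [hfix, hp, hcon]⟩
  have hs : ∃ n : ℕ, Separated α (T^[n] x) (T^[n] p) := ⟨i, hsep⟩
  have hlt : symDist α T r x p < r ^ n := hx
  rw [symDist, dif_pos hs] at hlt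
  refine absurd hlt (not_lt.2 (pow_le_pow_of_le_one hr.le hr1.le ?_))
  have := Nat.find_min' hs hsep
  have := i.2
  omega

/-! ### Constancy on images and values at fixed points -/

namespace IsGibbsMarkov

variable [MeasurableSpace Ω] {μ : Measure Ω} {α : Set (Set Ω)} {T : Ω → Ω} {r : ℝ}

/-- A transfer function of an `α`-measurable function is constant on the images of the members
of the partition. -/
theorem exists_ae_eq_const_on_image [IsProbabilityMeasure μ] (hT : IsGibbsMarkov μ α T r)
    (hμ : MeasurePreserving T μ μ) {f : Ω → ℝ} (hf : MeasurableMod μ α f)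
    {κ : ℝ} {g : Ω → ℂ} (hg : Measurable g) (hg1 : ∀ x, ‖g x‖ ≤ 1)
    (hfg : ∀ᵐ x ∂μ, g x = Complex.exp (Complex.I * (κ * f x : ℝ)) * g (T x))
    {a : Set Ω} (ha : a ∈ α) : ∃ z, ∀ᵐ y ∂μ, y ∈ T '' a → g y = g z := by
  obtain ⟨h, hh, hfh⟩ := hf
  have hlip : ∀ a ∈ α, ∀ x ∈ a, ∀ y ∈ a, |h x - h y| ≤ 0 * symDist α T r x y :=
    fun b hb x hx y hy => by
      rw [eq_of_measurable_generateFrom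
        (fun t ht => mem_iff_of_mem_partition hT.partition hb hx hy ht) hh]
      simp
  have hhg : ∀ᵐ x ∂μ, g x = Complex.exp (Complex.I * (κ * h x : ℝ)) * g (T x) := by
    filter_upwards [hfg, hfh] with x hx hx'
    rwa [← hx']
  -- With `D = 0` the oscillation bound vanishes; the empty word `j = 0` imposes no restriction, its
  -- cylinder being all of `Ω`.
  have key := hT.ae_norm_sub_le hμ le_rfl hlip hg hg1 hhg ha (j := 0) (d := fun _ => a)
    (fun _ => ha)
  obtain ⟨x, hxa, hx⟩ := ((frequently_ae_mem_iff.2 (hT.measure_image_pos ha).ne').and_eventually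
    key).exists
  refine ⟨x, ?_⟩
  filter_upwards [hx] with y hy hya
  have := hy hxa (mem_cyl.2 fun i => i.elim0) hya (mem_cyl.2 fun i => i.elim0)
  simp only [zero_div, zero_mul, mul_zero, norm_le_zero_iff, sub_eq_zero] at this
  exact this.symm

/-- At a fixed point all of whose neighbourhoods have positive measure, a locally Lipschitz
function with a transfer function takes a trivial value. -/
theorem exp_eq_one_of_fixed [IsProbabilityMeasure μ] (hT : IsGibbsMarkov μ α T r)
    (hμ : MeasurePreserving T μ μ) {f : Ω → ℝ} (hf : LocallyLip α T r f)
    {κ : ℝ} {g : Ω → ℂ} (hg : Measurable g) (hg1 : ∀ x, ‖g x‖ ≤ 1) (hg0 : ∀ᵐ x ∂μ, g x ≠ 0)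
    (hfg : ∀ᵐ x ∂μ, g x = Complex.exp (Complex.I * (κ * f x : ℝ)) * g (T x))
    {p : Ω} (hp : T p = p) {a : Set Ω} (ha : a ∈ α) (hpa : p ∈ a)
    (hball : ∀ ε > 0, 0 < μ (symBall α T r p ε)) :
    Complex.exp (Complex.I * (κ * f p : ℝ)) = 1 := by
  obtain ⟨D', hD'⟩ := hf
  have hr := hT.r_pos
  have hr1 := hT.r_lt_one
  set D := |D'| with hDdef
  have hD : 0 ≤ D := abs_nonneg D'
  have hlip : ∀ a ∈ α, ∀ x ∈ a, ∀ y ∈ a, |f x - f y| ≤ D * symDist α T r x y :=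
    fun b hb x hx y hy => (hD' b hb x hx y hy).trans
      (mul_le_mul_of_nonneg_right (le_abs_self D') (symDist_nonneg hr x y))
  let P : (n : ℕ) → Set Ω := fun n => cyl T fun _ : Fin n => a
  have hPpos : ∀ n, μ (P n) ≠ 0 := fun n =>
    ((hball (r ^ n) (by positivity)).trans_le
      (measure_mono fun x hx => mem_cyl_of_mem_symBall hr hr1 ha hpa hp hx)).ne'
  have hPsub : ∀ n, P (n + 1) ⊆ a := fun n x hx => mem_cyl.1 hx 0
  have hPmono : ∀ n, P (n + 1) ⊆ P n := fun n x hx =>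
    mem_cyl.2 fun i => mem_cyl.1 hx i.castSucc
  have hPT : ∀ n, ∀ x ∈ P (n + 1), T x ∈ P n := fun n x hx => by
    have hx' : x ∈ a ∩ T ⁻¹' P n := by
      have := cyl_succ T (fun _ : Fin (n + 1) => a)
      exact this ▸ hx
    exact hx'.2
  have hpP : ∀ n, p ∈ P n := fun n => mem_cyl.2 fun i => by
    rwa [Function.iterate_fixed hp]
  -- `P 2` has positive measure and `T` maps it into `a ∩ T '' a`, so `T '' a` covers `a` mod `μ`.
  have haT : ∀ᵐ x ∂μ, x ∈ a → x ∈ T '' a := by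
    have h0 : μ (a \ T '' a) = 0 := by
      refine (hT.subset_or_disjoint_image ha ha).resolve_right fun h => hPpos 2 ?_
      refine measure_mono_null (fun x hx => ?_) (hT.quasiMeasurePreserving.preimage_null h)
      exact ⟨hPsub 0 (hPT 1 x hx), x, hPsub 1 hx, rfl⟩
    filter_upwards [measure_eq_zero_iff_ae_notMem.1 h0] with x hx hxa
    by_contra hcon
    exact hx ⟨hxa, hcon⟩
  -- The modulus of `g` is `T`-invariant, i.e. it solves the same equation with `κ = 0`, so its
  -- oscillation on `T '' a` is zero.
  obtain ⟨c, hc0, hc⟩ : ∃ c : ℝ, 0 < c ∧ ∀ᵐ x ∂μ, x ∈ a → ‖g x‖ = c := by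
    have hnorm : ∀ᵐ x ∂μ, ((‖g x‖ : ℝ) : ℂ) =
        Complex.exp (Complex.I * (0 * f x : ℝ)) * ((‖g (T x)‖ : ℝ) : ℂ) := by
      filter_upwards [hfg] with x hx
      rw [hx, norm_mul, Complex.norm_exp_I_mul_ofReal]
      simp
    have key := hT.ae_norm_sub_le hμ hD hlip (g := fun x => ((‖g x‖ : ℝ) : ℂ))
      (Complex.measurable_ofReal.comp hg.norm) (fun x => by simpa using hg1 x) hnorm ha (j := 0)
      (d := fun _ => a) (fun _ => ha)
    obtain ⟨x, hxa, hx, hx0, hxT⟩ := ((frequently_ae_mem_iff.2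
      (hT.measure_pos ha).ne').and_eventually (key.and (hg0.and haT))).exists
    refine ⟨‖g x‖, norm_pos_iff.2 hx0, ?_⟩
    filter_upwards [hx, haT] with y hy hyT hya
    have := hy (hxT hxa) (mem_cyl.2 fun i => i.elim0) (hyT hya) (mem_cyl.2 fun i => i.elim0)
    simp only [abs_zero, zero_mul, mul_zero, norm_le_zero_iff, sub_eq_zero] at this
    exact (Complex.ofReal_injective this).symm
  -- The a.e. relations may fail at `p`, so they are used at a generic `y` close to `p`. Taking `y ∈
  -- P (n + 2)` puts both `y` and `T y` in `P (n + 1)`; comparing each with `x` costs twice the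
  -- oscillation bound, hence the factor `4`. The term `|κ| * D` pays for replacing `f y` by `f p`.
  have hbound : ∀ n : ℕ, ‖Complex.exp (Complex.I * (κ * f p : ℝ)) - 1‖ ≤
      (|κ| * D + 4 * (|κ| * (D / (1 - r))) / c) * r ^ (n + 1) := fun n => by
    have key := hT.ae_norm_sub_le hμ hD hlip hg hg1 hfg ha (j := n + 1) (d := fun _ => a)
      (fun _ => ha)
    obtain ⟨x, hxP, hx, hxT⟩ := ((frequently_ae_mem_iff.2 (hPpos (n + 1))).and_eventually
      (key.and haT)).exists
    have hx' : ∀ᵐ y ∂μ, y ∈ P (n + 1) →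
        ‖g x - g y‖ ≤ 2 * (|κ| * (D / (1 - r) * r ^ (n + 1))) := by
      filter_upwards [hx, haT] with y hy hyT hyP
      exact hy (hxT (hPsub n hxP)) hxP (hyT (hPsub n hyP)) hyP
    obtain ⟨y, hyP, hy1, hy2, hyg, hyc⟩ := ((frequently_ae_mem_iff.2
      (hPpos (n + 2))).and_eventually (hx'.and ((hT.quasiMeasurePreserving.ae hx').and
        (hfg.and (hT.quasiMeasurePreserving.ae hc))))).exists
    have hTy := hPT (n + 1) y hyP
    replace hy1 := hy1 (hPmono _ hyP)
    replace hy2 := hy2 hTy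
    replace hyc := hyc (hPsub n hTy)
    have h1 : ‖Complex.exp (Complex.I * (κ * f y : ℝ)) - 1‖ * c ≤
        4 * (|κ| * (D / (1 - r))) * r ^ (n + 1) := by
      rw [← hyc, ← norm_mul, sub_mul, one_mul, ← hyg]
      have := norm_sub_le_norm_sub_add_norm_sub (g y) (g x) (g (T y))
      rw [norm_sub_rev (g y) (g x)] at this
      linarith
    have h2 : |f p - f y| ≤ D * r ^ (n + 1) := by
      refine (hlip a ha p hpa y (hPsub _ hyP)).trans (mul_le_mul_of_nonneg_left ?_ hD)
      exact symDist_le hr hr1 fun i hi =>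
        not_separated_of_mem_cyl hT.partition (fun _ => ha) (hpP (n + 1)) (hPmono _ hyP) hi
    have h3 : ‖Complex.exp (Complex.I * (κ * f p : ℝ)) - Complex.exp (Complex.I * (κ * f y : ℝ))‖
        ≤ |κ| * D * r ^ (n + 1) := by
      refine (norm_exp_I_mul_sub_le _ _).trans ?_
      rw [← mul_sub, abs_mul, mul_assoc]
      exact mul_le_mul_of_nonneg_left h2 (abs_nonneg κ)
    have h4 : ‖Complex.exp (Complex.I * (κ * f y : ℝ)) - 1‖ ≤
        4 * (|κ| * (D / (1 - r))) / c * r ^ (n + 1) := by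
      rw [div_mul_eq_mul_div]
      exact (le_div_iff₀ hc0).2 h1
    refine (norm_sub_le_norm_sub_add_norm_sub _ _ _).trans ((add_le_add h3 h4).trans ?_)
    rw [add_mul]
  have hlim : Tendsto (fun n : ℕ => (|κ| * D + 4 * (|κ| * (D / (1 - r))) / c) * r ^ (n + 1)) atTop
      (𝓝 ((|κ| * D + 4 * (|κ| * (D / (1 - r))) / c) * 0)) :=
    ((tendsto_pow_atTop_nhds_zero_of_lt_one hr.le hr1).comp (tendsto_add_atTop_nat 1)).const_mul _
  rw [mul_zero] at hlim
  exact sub_eq_zero.1 (norm_le_zero_iff.1 (ge_of_tendsto' hlim hbound))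

end IsGibbsMarkov

end GibbsMarkov

theorem proposition4 {Ω : Type*} [MeasurableSpace Ω] (μ : Measure Ω) [IsProbabilityMeasure μ]
    (α : Set (Set Ω)) (T : Ω → Ω) (r : ℝ)
    (hT : GibbsMarkov.IsGibbsMarkov μ α T r)
    (hmix : GibbsMarkov.TopMixing μ α T)
    (hμ : MeasurePreserving T μ μ)
    (f : Ω → ℝ) (hf : Measurable f)
    (k : ℤ) (hk : k ≠ 0) (g : Ω → ℂ) (hg : Measurable g)
    (hfg : ∀ᵐ x ∂μ,
      Complex.exp (2 * Real.pi * Complex.I * (k : ℂ) * (f x : ℂ)) = g x / g (T x)) :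
    (GibbsMarkov.MeasurableMod μ α f →
      (∃ β, GibbsMarkov.IsImagePartition μ α T β) ∧
      ∀ β, GibbsMarkov.IsImagePartition μ α T β → GibbsMarkov.MeasurableMod μ β g) ∧
    (GibbsMarkov.LocallyLip α T r f →
      ∀ p : Ω, T p = p →
        -- `p` lies in the interior of a member of `α`
        (∃ a ∈ α, ∃ ε > 0, GibbsMarkov.symBall α T r p ε ⊆ a) →
        -- every open ball around `p` has positive measure
        (∀ ε > 0, 0 < μ (GibbsMarkov.symBall α T r p ε)) →
        -- `T` is continuous at `p`
        (∀ ε > 0, ∃ δ > 0, ∀ x ∈ GibbsMarkov.symBall α T r p δ,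
          T x ∈ GibbsMarkov.symBall α T r (T p) ε) →
        -- `f` is continuous at `p`
        (∀ ε > 0, ∃ δ > 0, ∀ x ∈ GibbsMarkov.symBall α T r p δ, |f x - f p| < ε) →
        Complex.exp (2 * Real.pi * Complex.I * (k : ℂ) * (f p : ℂ)) = 1) := by
  have hexp : ∀ t : ℝ, Complex.exp (2 * Real.pi * Complex.I * (k : ℂ) * (t : ℂ)) =
      Complex.exp (Complex.I * (2 * Real.pi * k * t : ℝ)) := fun t => by
    congr 1
    push_cast
    ring
  simp only [hexp] at hfg ⊢
  have hne : ∀ᵐ x ∂μ, g x ≠ 0 := by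
    filter_upwards [hfg] with x hx h0
    rw [h0, zero_div] at hx
    exact Complex.exp_ne_zero _ hx
  -- The regularity results need a function bounded by `1`; the embedded `g` satisfies the same
  -- equation because the phase has modulus `1`.
  have hg1 := GibbsMarkov.measurable_discEmbed.comp hg
  have hle : ∀ x, ‖(GibbsMarkov.discEmbed ∘ g) x‖ ≤ 1 := fun x =>
    GibbsMarkov.norm_discEmbed_le_one _
  have hfg1 : ∀ᵐ x ∂μ, (GibbsMarkov.discEmbed ∘ g) x =
      Complex.exp (Complex.I * (2 * Real.pi * k * f x : ℝ)) *
        (GibbsMarkov.discEmbed ∘ g) (T x) := by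
    filter_upwards [hfg, hT.quasiMeasurePreserving.ae hne] with x hx hx0
    rw [Function.comp_apply, Function.comp_apply,
      ← GibbsMarkov.discEmbed_mul (Complex.norm_exp_I_mul_ofReal _), hx, div_mul_cancel₀ _ hx0]
  refine ⟨fun hfα => ?_, fun hlip p hp ⟨a, ha, ε, hε, hball⟩ hpos _ _ => ?_⟩
  · obtain ⟨β₀, hβ₀, himage⟩ := hT.exists_isImagePartition
    refine ⟨⟨β₀, hβ₀⟩, fun β hβ => GibbsMarkov.measurableMod_of_ae_const hβ.1.1 fun b hb => ?_⟩
    -- Finestness of `β` places `b` inside a member of the explicit partition `β₀`, and so inside a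
    -- single image `T '' a`, where `g` is constant.
    obtain ⟨b₀, hb₀, hbb₀⟩ := hβ.2 β₀ hβ₀.1 b hb
    obtain ⟨a, ha, hb₀a⟩ := himage b₀ hb₀
    obtain ⟨z, hz⟩ := hT.exists_ae_eq_const_on_image hμ hfα hg1 hle hfg1 ha
    refine ⟨g z, ?_⟩
    filter_upwards [hz, measure_eq_zero_iff_ae_notMem.1 hbb₀,
      measure_eq_zero_iff_ae_notMem.1 hb₀a] with x hx h1 h2 hxb
    refine GibbsMarkov.discEmbed_injective (hx ?_)
    by_contra hxa
    exact h2 ⟨by_contra fun h => h1 ⟨hxb, h⟩, hxa⟩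
  · have hpa : p ∈ a := hball <| by
      have : GibbsMarkov.symDist α T r p p = 0 := dif_neg fun ⟨n, b, _, h⟩ => h Iff.rfl
      simpa [GibbsMarkov.symBall, this] using hε
    exact hT.exp_eq_one_of_fixed hμ hlip hg1 hle
      (hne.mono fun x hx => GibbsMarkov.discEmbed_ne_zero hx) hfg1 hp ha hpa hpos
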